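/- Consider the mobile layer (ML) of a two-layer spatial-modulation-aided layered-division-multiplexing (SM-LDM) downlink with $N_t\ge 1$ transmit antennas and $N_r$ receive antennas at the mobile receiver, transmit powers $\rho_{ml}>\rho_{fl}>0$ of the mobile and the fixed layer, and noise variance $\sigma^2>0$. The channel matrix $\mathbf H=[\mathbf h_1,\dots,\mathbf h_{N_t}]\in\mathbb C^{N_r\times N_t}$ has i.i.d. $\mathcal{CN}(0,1)$ entries. Let $\mathbf g_n=\mathbf g_n(\mathbf H)\in\mathbb C^{N_r}$, $1\le n\le N_t$, be arbitrary linear combining vectors such that all entries of $\mathbf g_n$ and all gains $\mathbf g_n^H\mathbf h_k$ are square-integrable and $E\{\mathbf g_n^H\mathbf h_n\}\neq 0$. Put $$\mathrm{SINR}_n=\frac{\frac{\rho_{ml}}{N_t}\left|E\{\mathbf g_n^H\mathbf h_n\}\right|^2}{\sum_{k=1}^{N_t}\frac{\rho_{ml}}{N_t}E\{|\mathbf g_n^H\mathbf h_k|^2\}-\frac{\rho_{ml}}{N_t}\left|E\{\mathbf g_n^H\mathbf h_n\}\right|^2+\sum_{m=1}^{N_t}\frac{\rho_{fl}}{N_t}E\{|\mathbf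 g_n^H\mathbf h_m|^2\}+\sigma^2E\{\|\mathbf g_n\|^2\}}.$$ The spectral efficiency of ML with this linear combining is the mutual information $I(\hat{\mathbf y};\mathbf x)$, in bits, of the equivalent additive-noise channel $\hat{\mathbf y}=\mathbf x+\mathbf w$, where $\mathbf x=\sqrt{N_t}\,s\,\mathbf e_a$ is the spatial modulation symbol normalized to unit average power per antenna, $s\sim\mathcal{CN}(0,1)$ is the constellation symbol, the active antenna $a$ is uniform on $\{1,\dots,N_t\}$, $\mathbf e_a$ is the $a$-th standard basis vector, $\mathbf w\sim\mathcal{CN}\big(\mathbf 0,\mathrm{diag}\{1/\mathrm{SINR}_1,\dots,1/\mathrm{SINR}_{N_t}\}\big)$, and $s,a,\mathbf w$ are independent. Then $I(\hat{\mathbf y};\mathbf x)$ is finite and $$I(\hat{\mathbf y};\mathbf x)\ \ge\ \log_2 N_t-N_t+\frac1{N_t}\left\{\sum_{n=1}^{N_t}\log_2\left(1+N_t\,\mathrm{SINR}_n\right)-\sum_{n=1}^{N_t}\log_2\left[\sum_{k=1}^{N_t}\frac{\det\mathbf\Sigma_n}{\det(\mathbf\Sigma_n+\mathbf\Sigma_k)}\right]\right\},$$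 where $\mathbf\Sigma_n=\mathrm{diag}\{1/\mathrm{SINR}_1,\dots,1/\mathrm{SINR}_{N_t}\}+N_t\,\mathrm{diag}\{\mathbf e_n\}$. -/

import Mathlib

open MeasureTheory ProbabilityTheory
open scoped ENNReal NNReal

noncomputable section

namespace SMLDM

/-- The circularly symmetric complex Gaussian distribution `CN(0, v)` on `ℂ`: the real and the
imaginary part are independent real Gaussians with mean `0` and variance `v / 2`. -/
def complexGaussian (v : ℝ) : Measure ℂ :=
  ((gaussianReal 0 (v / 2).toNNReal).prod (gaussianReal 0 (v / 2).toNNReal)).map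
    (fun p : ℝ × ℝ => (p.1 : ℂ) + (p.2 : ℂ) * Complex.I)

/-- The distribution `CN(0, diag d)` on `ℂ^N` (the coordinates are independent). -/
def complexGaussianDiag {N : ℕ} (d : Fin N → ℝ) : Measure (Fin N → ℂ) :=
  Measure.pi (fun i => complexGaussian (d i))

/-- Realizations of the `Nr × Nt` channel matrix, stored by columns: `H n` is the column `h_n`
belonging to the `n`-th transmit antenna. -/
abbrev Channel (Nt Nr : ℕ) : Type := Fin Nt → Fin Nr → ℂ

/-- The law of the Rayleigh fading channel: all entries are i.i.d. `CN(0, 1)`. -/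
def rayleigh (Nt Nr : ℕ) : Measure (Channel Nt Nr) :=
  Measure.pi (fun _ => Measure.pi (fun _ => complexGaussian 1))

variable {Nt Nr : ℕ}

/-- The gain `g_n^H h_k` for the channel realization `H`, where the combining vector `g_n = g n H`
of the `n`-th transmit antenna depends on the channel realization. -/
def gain (g : Fin Nt → Channel Nt Nr → Fin Nr → ℂ) (n k : Fin Nt) (H : Channel Nt Nr) : ℂ :=
  ∑ r, star (g n H r) * H k r

/-- The SINR of the mobile layer for the `n`-th transmit antenna. -/
def sinr (ρml ρfl σsq : ℝ) (g : Fin Nt → Channel Nt Nr → Fin Nr → ℂ) (n : Fin Nt) : ℝ :=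
  (ρml / Nt * ‖∫ H, gain g n n H ∂(rayleigh Nt Nr)‖ ^ 2) /
    ((∑ k, ρml / Nt * ∫ H, ‖gain g n k H‖ ^ 2 ∂(rayleigh Nt Nr))
      - ρml / Nt * ‖∫ H, gain g n n H ∂(rayleigh Nt Nr)‖ ^ 2
      + (∑ m, ρfl / Nt * ∫ H, ‖gain g n m H‖ ^ 2 ∂(rayleigh Nt Nr))
      + σsq * ∫ H, ∑ r, ‖g n H r‖ ^ 2 ∂(rayleigh Nt Nr))

/-- The diagonal covariance matrix `Σ_n = diag(1 / SINR_1, …, 1 / SINR_Nt) + Nt diag(e_n)`. -/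
def covMatrix (S : Fin Nt → ℝ) (n : Fin Nt) : Matrix (Fin Nt) (Fin Nt) ℝ :=
  Matrix.diagonal (fun i => 1 / S i) + (Nt : ℝ) • Matrix.diagonal (Pi.single n 1)

/-- The closed-form lower bound on the spectral efficiency, in bits. -/
def seBound (S : Fin Nt → ℝ) : ℝ :=
  Real.logb 2 Nt - Nt + 1 / Nt *
    ((∑ n, Real.logb 2 (1 + Nt * S n))
      - ∑ n, Real.logb 2 (∑ k, (covMatrix S n).det / (covMatrix S n + covMatrix S k).det))

/-- The normalized spatial modulation symbol `x = √Nt s e_a`: the constellation symbol `s` is sent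
on the active antenna `a`; every antenna has average power `1` if `s` has power `1` and `a` is
uniformly distributed. -/
def smSymbol (s : ℂ) (a : Fin Nt) : Fin Nt → ℂ :=
  Pi.single a ((Real.sqrt Nt : ℂ) * s)

/-- The mutual information `I(X; Y)` in nats, the Kullback–Leibler divergence of the joint law from
the product of the marginal laws. -/
def mutualInfo {Ω α β : Type*} [MeasurableSpace Ω] [MeasurableSpace α] [MeasurableSpace β]
    (X : Ω → α) (Y : Ω → β) (P : Measure Ω) : ℝ≥0∞ :=
  InformationTheory.klDiv (P.map (fun ω => (X ω, Y ω))) ((P.map X).prod (P.map Y))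

end SMLDM

end

/-! Given that antenna `n` is active, the output is `CN(0, Σ_n)` with density `p_n`, so the output
law is the uniform mixture `q = (1/N) ∑ p_k`. For additive noise the mutual information is the
difference of differential entropies, `E log f(W) - E log q(Y)` with `f` the noise density.
Everything therefore rests on an upper bound for `∑_n E_n log ∑_k p_k`, where `E_n` is the
expectation under `p_n`.

Jensen's inequality applied directly to `E_n log q` leaves a gap between entropies and
log-determinants. Instead, positive weights `h_n` are introduced and the mixture is written as `∑ p
= p_n · (∑ h / h_n) · ((∑ p) h_n / (p_n ∑ h))`. The first factor yields the exact entropy of a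
component. The second is bounded by Jensen. The third contributes at most zero after summation over
`n`: this is Gibbs' inequality between the posterior weights `p_n / ∑ p` and `h_n / ∑ h`
(`sum_integral_log_sum_le`).

Take `h_n` to be the density of `CN(0, 2Σ_n)`, proportional to `√p_n`. Then `E_n[h_j / h_n] = 2^N
det Σ_n / det(Σ_n + Σ_j)`, which is the determinant ratio of the bound; the factor `2^N` is the term
`-N` in bits. (The choice `h = p` would make all these expectations 1 and lose all information
carried by the antenna index.) -/

namespace SMLDM

/-! ### Densities of complex Gaussian laws. -/

noncomputable section

/-- The density of `CN(0, v)` with respect to the Lebesgue measure. -/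
def gaussDensity (v : ℝ) (z : ℂ) : ℝ := (Real.pi * v)⁻¹ * Real.exp (-‖z‖ ^ 2 / v)

/-- The density of `CN(0, diag d)` with respect to the Lebesgue measure. -/
def gaussDiagDensity {N : ℕ} (d : Fin N → ℝ) (y : Fin N → ℂ) : ℝ := ∏ i, gaussDensity (d i) (y i)

end

lemma gaussDensity_pos {v : ℝ} (hv : 0 < v) (z : ℂ) : 0 < gaussDensity v z := by
  unfold gaussDensity; positivity

lemma gaussDiagDensity_pos {N : ℕ} {d : Fin N → ℝ} (hd : ∀ i, 0 < d i) (y : Fin N → ℂ) :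
    0 < gaussDiagDensity d y :=
  Finset.prod_pos fun i _ => gaussDensity_pos (hd i) _

@[fun_prop]
lemma measurable_gaussDensity (v : ℝ) : Measurable (gaussDensity v) := by
  unfold gaussDensity; fun_prop

@[fun_prop]
lemma measurable_gaussDiagDensity {N : ℕ} (d : Fin N → ℝ) : Measurable (gaussDiagDensity d) := by
  unfold gaussDiagDensity
  exact Finset.measurable_fun_prod _ fun i _ =>
    (measurable_gaussDensity (d i)).comp (measurable_pi_apply i)

instance isProbabilityMeasure_complexGaussian (v : ℝ) :
    IsProbabilityMeasure (complexGaussian v) := by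
  unfold complexGaussian
  exact Measure.isProbabilityMeasure_map (by fun_prop)

instance isProbabilityMeasure_complexGaussianDiag {N : ℕ} (d : Fin N → ℝ) :
    IsProbabilityMeasure (complexGaussianDiag d) := by
  unfold complexGaussianDiag; infer_instance

instance isProbabilityMeasure_rayleigh (Nt Nr : ℕ) : IsProbabilityMeasure (rayleigh Nt Nr) := by
  unfold rayleigh; infer_instance

lemma complexGaussian_eq_withDensity {v : ℝ} (hv : 0 < v) :
    complexGaussian v = volume.withDensity fun z => ENNReal.ofReal (gaussDensity v z) := by
  have hv2 : (v / 2).toNNReal ≠ 0 := by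
    rw [Ne, Real.toNNReal_eq_zero]; linarith
  have hfun : (fun p : ℝ × ℝ => (p.1 : ℂ) + (p.2 : ℂ) * Complex.I)
      = Complex.measurableEquivRealProd.symm := by
    ext p
    rw [Complex.measurableEquivRealProd_symm_apply]
    apply Complex.ext <;> simp
  have hmp := Complex.volume_preserving_equiv_real_prod.symm
  unfold complexGaussian
  rw [gaussianReal_of_var_ne_zero _ hv2, prod_withDensity (by fun_prop) (by fun_prop), hfun]
  refine Measure.ext_of_lintegral _ fun φ hφ => ?_
  rw [lintegral_map hφ (MeasurableEquiv.measurable _),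
    lintegral_withDensity_eq_lintegral_mul _ (by fun_prop)
      (g := fun p => φ (Complex.measurableEquivRealProd.symm p))
      (hφ.comp (MeasurableEquiv.measurable _)),
    lintegral_withDensity_eq_lintegral_mul _ (by fun_prop) hφ]
  rw [← hmp.lintegral_comp (by fun_prop)]
  refine lintegral_congr fun p => ?_
  simp only [Pi.mul_apply]
  congr 1
  rw [Complex.measurableEquivRealProd_symm_apply]
  simp only [gaussianPDF, gaussianPDFReal, gaussDensity]
  rw [← ENNReal.ofReal_mul (by positivity)]
  congr 1
  have hn : ‖(⟨p.1, p.2⟩ : ℂ)‖ ^ 2 = p.1 ^ 2 + p.2 ^ 2 := by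
    rw [← Complex.normSq_eq_norm_sq, Complex.normSq_mk]; ring
  rw [hn, Real.coe_toNNReal _ (by positivity)]
  have h1 : 2 * Real.pi * (v / 2) = Real.pi * v := by ring
  have h2 : 2 * (v / 2) = v := by ring
  rw [h1, h2, mul_mul_mul_comm, ← mul_inv, Real.mul_self_sqrt (by positivity), ← Real.exp_add]
  congr 2
  ring

lemma lintegral_gaussDensity {v : ℝ} (hv : 0 < v) :
    ∫⁻ z, ENNReal.ofReal (gaussDensity v z) = 1 := by
  have h : complexGaussian v Set.univ = 1 := measure_univ
  rwa [complexGaussian_eq_withDensity hv, withDensity_apply _ .univ, Measure.restrict_univ] at h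

lemma integrable_gaussDensity {v : ℝ} (hv : 0 < v) : Integrable (gaussDensity v) := by
  refine ⟨(measurable_gaussDensity v).aestronglyMeasurable, ?_⟩
  rw [hasFiniteIntegral_iff_ofReal (ae_of_all _ fun z => (gaussDensity_pos hv z).le),
    lintegral_gaussDensity hv]
  exact ENNReal.one_lt_top

lemma complexGaussianDiag_eq_withDensity {N : ℕ} {d : Fin N → ℝ} (hd : ∀ i, 0 < d i) :
    complexGaussianDiag d = volume.withDensity fun y => ENNReal.ofReal (gaussDiagDensity d y) := by
  refine Measure.pi_eq fun s hs => ?_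
  rw [withDensity_apply _ (MeasurableSet.univ_pi hs)]
  have hint : Integrable (gaussDiagDensity d) :=
    Integrable.fintype_prod fun i => integrable_gaussDensity (hd i)
  rw [← ofReal_integral_eq_lintegral_ofReal hint.integrableOn
    (ae_of_all _ fun y => (gaussDiagDensity_pos hd y).le),
    ← integral_indicator (MeasurableSet.univ_pi hs)]
  have hfac : (Set.univ.pi s).indicator (gaussDiagDensity d)
      = fun y => ∏ i, (s i).indicator (gaussDensity (d i)) (y i) := by
    ext y
    by_cases hy : y ∈ Set.univ.pi s
    · rw [Set.indicator_of_mem hy]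
      exact Finset.prod_congr rfl fun i _ => (Set.indicator_of_mem (hy i trivial) _).symm
    · rw [Set.indicator_of_notMem hy]
      obtain ⟨i, hi⟩ : ∃ i, y i ∉ s i := by simpa [Set.mem_pi] using hy
      exact (Finset.prod_eq_zero (Finset.mem_univ i) (Set.indicator_of_notMem hi _)).symm
  rw [hfac, integral_fintype_prod_volume_eq_prod, ENNReal.ofReal_prod_of_nonneg]
  · refine Finset.prod_congr rfl fun i _ => ?_
    rw [integral_indicator (hs i), complexGaussian_eq_withDensity (hd i),
      withDensity_apply _ (hs i), ofReal_integral_eq_lintegral_ofReal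
        (integrable_gaussDensity (hd i)).integrableOn
        (ae_of_all _ fun y => (gaussDensity_pos (hd i) y).le)]
  · intro i _
    exact integral_nonneg fun z => Set.indicator_nonneg (fun z _ => (gaussDensity_pos (hd i) z).le) z

lemma integrable_gaussDiagDensity {N : ℕ} {d : Fin N → ℝ} (hd : ∀ i, 0 < d i) :
    Integrable (gaussDiagDensity d) :=
  Integrable.fintype_prod fun i => integrable_gaussDensity (hd i)

lemma integral_gaussDiagDensity {N : ℕ} {d : Fin N → ℝ} (hd : ∀ i, 0 < d i) :
    ∫ y, gaussDiagDensity d y = 1 := by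
  have h : complexGaussianDiag d Set.univ = 1 := measure_univ
  rw [complexGaussianDiag_eq_withDensity hd, withDensity_apply _ .univ, Measure.restrict_univ,
    ← ofReal_integral_eq_lintegral_ofReal (integrable_gaussDiagDensity hd)
      (ae_of_all _ fun y => (gaussDiagDensity_pos hd y).le)] at h
  simpa using h

/-! ### Characteristic functions: stability under sums and real scaling. -/

lemma charFun_complexGaussian {v : ℝ} (hv : 0 ≤ v) (t : ℂ) :
    charFun (complexGaussian v) t = Complex.exp (-(v * ‖t‖ ^ 2 / 4 : ℝ)) := by
  have hn : ‖t‖ ^ 2 = t.re ^ 2 + t.im ^ 2 := by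
    rw [← Complex.normSq_eq_norm_sq, Complex.normSq_apply]; ring
  have key : ∀ p : ℝ × ℝ, Complex.exp (inner ℝ ((p.1 : ℂ) + (p.2 : ℂ) * Complex.I) t * Complex.I)
      = Complex.exp (t.re * p.1 * Complex.I) * Complex.exp (t.im * p.2 * Complex.I) := by
    intro p
    rw [← Complex.exp_add, Complex.inner]
    congr 1
    simp
    ring
  rw [charFun_apply, complexGaussian, integral_map (by fun_prop) (by fun_prop)]
  simp_rw [key]
  rw [integral_prod_mul (fun x : ℝ => Complex.exp (t.re * x * Complex.I))
    (fun x : ℝ => Complex.exp (t.im * x * Complex.I)), ← charFun_apply_real, ← charFun_apply_real,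
    charFun_gaussianReal, charFun_gaussianReal, ← Complex.exp_add, hn,
    Real.coe_toNNReal _ (by positivity)]
  congr 1
  push_cast
  ring

lemma complexGaussian_conv {u v : ℝ} (hu : 0 ≤ u) (hv : 0 ≤ v) :
    complexGaussian u ∗ complexGaussian v = complexGaussian (u + v) := by
  refine Measure.ext_of_charFun ?_
  ext t
  rw [charFun_conv, charFun_complexGaussian hu, charFun_complexGaussian hv,
    charFun_complexGaussian (add_nonneg hu hv), ← Complex.exp_add]
  congr 1
  push_cast
  ring

lemma complexGaussian_map_mul {v : ℝ} (hv : 0 ≤ v) (r : ℝ) :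
    (complexGaussian v).map (fun z => (r : ℂ) * z) = complexGaussian (r ^ 2 * v) := by
  have hr : (fun z : ℂ => (r : ℂ) * z) = fun z => r • z := by ext z; simp
  have : IsProbabilityMeasure ((complexGaussian v).map fun z : ℂ => r • z) :=
    Measure.isProbabilityMeasure_map (by fun_prop)
  rw [hr]
  refine Measure.ext_of_charFun ?_
  ext t
  rw [charFun_map_smul, charFun_complexGaussian hv, charFun_complexGaussian (by positivity),
    norm_smul, mul_pow, Real.norm_eq_abs, sq_abs]
  congr 3
  ring

/-! ### Second moments and Gaussian entropy. -/

lemma integrable_norm_sq_complexGaussian (v : ℝ) :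
    Integrable (fun z : ℂ => ‖z‖ ^ 2) (complexGaussian v) := by
  unfold complexGaussian
  rw [integrable_map_measure (by fun_prop) (by fun_prop)]
  have h : Integrable (fun x : ℝ => x ^ 2) (gaussianReal 0 (v / 2).toNNReal) :=
    (memLp_id_gaussianReal 2).integrable_sq
  refine ((h.comp_fst _).add (h.comp_snd _)).congr (ae_of_all _ fun p => ?_)
  simp [← Complex.normSq_eq_norm_sq, Complex.normSq_apply]
  ring

lemma integral_norm_sq_complexGaussian {v : ℝ} (hv : 0 ≤ v) :
    ∫ z, ‖z‖ ^ 2 ∂(complexGaussian v) = v := by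
  unfold complexGaussian
  rw [integral_map (by fun_prop) (by fun_prop)]
  have h : Integrable (fun x : ℝ => x ^ 2) (gaussianReal 0 (v / 2).toNNReal) :=
    (memLp_id_gaussianReal 2).integrable_sq
  have hval : ∫ x, x ^ 2 ∂(gaussianReal 0 (v / 2).toNNReal) = v / 2 := by
    have := variance_fun_id_gaussianReal (μ := 0) (v := (v / 2).toNNReal)
    rw [variance_of_integral_eq_zero (by fun_prop) (by simp), Real.coe_toNNReal _ (by positivity)]
      at this
    exact this
  have hcong : ∀ p : ℝ × ℝ, ‖(p.1 : ℂ) + (p.2 : ℂ) * Complex.I‖ ^ 2 = p.1 ^ 2 + p.2 ^ 2 := by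
    intro p
    simp [← Complex.normSq_eq_norm_sq, Complex.normSq_apply]
    ring
  simp_rw [hcong]
  rw [integral_add (h.comp_fst _) (h.comp_snd _), integral_fun_fst (fun x : ℝ => x ^ 2),
    integral_fun_snd (fun x : ℝ => x ^ 2), hval]
  simp

lemma log_gaussDiagDensity {N : ℕ} {d : Fin N → ℝ} (hd : ∀ i, 0 < d i) (y : Fin N → ℂ) :
    Real.log (gaussDiagDensity d y) = ∑ i, (-Real.log (Real.pi * d i) - ‖y i‖ ^ 2 / d i) := by
  unfold gaussDiagDensity
  rw [Real.log_prod fun i _ => (gaussDensity_pos (hd i) _).ne']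
  refine Finset.sum_congr rfl fun i _ => ?_
  have := hd i
  rw [gaussDensity, Real.log_mul (by positivity) (Real.exp_pos _).ne', Real.log_inv, Real.log_exp]
  ring

lemma integrable_norm_sq_eval_complexGaussianDiag {N : ℕ} (d : Fin N → ℝ) (i : Fin N) :
    Integrable (fun y : Fin N → ℂ => ‖y i‖ ^ 2) (complexGaussianDiag d) :=
  integrable_comp_eval (μ := fun i => complexGaussian (d i)) (f := fun z : ℂ => ‖z‖ ^ 2) (integrable_norm_sq_complexGaussian (d i))

lemma integrable_log_gaussDiagDensity {N : ℕ} {d : Fin N → ℝ} (hd : ∀ i, 0 < d i)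
    (u : Fin N → ℝ) :
    Integrable (fun y => Real.log (gaussDiagDensity d y)) (complexGaussianDiag u) := by
  simp_rw [log_gaussDiagDensity hd]
  exact integrable_finsetSum _ fun i _ =>
    (integrable_const _).sub ((integrable_norm_sq_eval_complexGaussianDiag u i).div_const _)

/-- The differential entropy of `CN(0, diag d)`, up to sign. -/
lemma integral_log_gaussDiagDensity {N : ℕ} {d : Fin N → ℝ} (hd : ∀ i, 0 < d i) :
    ∫ y, Real.log (gaussDiagDensity d y) ∂(complexGaussianDiag d)
      = -∑ i, Real.log (Real.pi * d i) - N := by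
  simp_rw [log_gaussDiagDensity hd]
  have hint : ∀ i ∈ Finset.univ, Integrable
      (fun y : Fin N → ℂ => -Real.log (Real.pi * d i) - ‖y i‖ ^ 2 / d i) (complexGaussianDiag d) :=
    fun i _ =>
      (integrable_const _).sub ((integrable_norm_sq_eval_complexGaussianDiag d i).div_const _)
  rw [integral_finsetSum _ hint]
  have : ∀ i, ∫ y, (-Real.log (Real.pi * d i) - ‖y i‖ ^ 2 / d i) ∂(complexGaussianDiag d)
      = -Real.log (Real.pi * d i) - 1 := by
    intro i
    rw [integral_sub (integrable_const _)
      ((integrable_norm_sq_eval_complexGaussianDiag d i).div_const _), integral_div]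
    have h : ∫ y, ‖y i‖ ^ 2 ∂(complexGaussianDiag d) = d i :=
      (integral_comp_eval (μ := fun i => complexGaussian (d i)) (f := fun z : ℂ => ‖z‖ ^ 2)
        (by fun_prop)).trans (integral_norm_sq_complexGaussian (hd i).le)
    rw [h, div_self (hd i).ne']
    simp
  simp_rw [this]
  simp [Finset.sum_sub_distrib]

/-! ### Perturbing one coordinate of a product law. -/

lemma measurable_single {N : ℕ} (n : Fin N) : Measurable fun z : ℂ => (Pi.single n z : Fin N → ℂ) := by
  refine measurable_pi_iff.2 fun i => ?_
  by_cases h : i = n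
  · subst h; simpa using measurable_id'
  · simp [Pi.single_eq_of_ne h]

/-- Adding an independent variable to the coordinate `n` of a vector with independent coordinates
convolves the law of this coordinate. -/
lemma map_single_add_prod_pi {N : ℕ} (κ : Measure ℂ) [IsProbabilityMeasure κ]
    (ν : Fin N → Measure ℂ) [∀ i, IsProbabilityMeasure (ν i)] (n : Fin N) :
    (κ.prod (Measure.pi ν)).map (fun q : ℂ × (Fin N → ℂ) => Pi.single n q.1 + q.2)
      = Measure.pi (Function.update ν n (κ ∗ ν n)) := by
  have hmeas : Measurable fun q : ℂ × (Fin N → ℂ) => (Pi.single n q.1 + q.2 : Fin N → ℂ) :=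
    ((measurable_single n).comp measurable_fst).add measurable_snd
  have : ∀ i, IsProbabilityMeasure (Function.update ν n (κ ∗ ν n) i) := by
    intro i
    by_cases h : i = n
    · subst h; rw [Function.update_self]; infer_instance
    · rw [Function.update_of_ne h]; infer_instance
  refine (Measure.pi_eq fun s hs => ?_).symm
  rw [Measure.map_apply hmeas (MeasurableSet.univ_pi hs),
    Measure.prod_apply (hmeas (MeasurableSet.univ_pi hs))]
  -- For fixed `z` the section of a box is again a box, and only its side `n` depends on `z`; hence
  -- the integral over `z` affects a single factor.
  have hbox : ∀ z : ℂ, (Prod.mk z ⁻¹' ((fun q : ℂ × (Fin N → ℂ) =>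
      (Pi.single n q.1 + q.2 : Fin N → ℂ)) ⁻¹' Set.univ.pi s))
      = Set.univ.pi fun i => (fun x => (Pi.single n z : Fin N → ℂ) i + x) ⁻¹' s i := by
    intro z; ext w; simp [Set.mem_pi]
  have hprod : ∀ z : ℂ, ∏ i, ν i ((fun x => (Pi.single n z : Fin N → ℂ) i + x) ⁻¹' s i)
      = ν n ((fun x => z + x) ⁻¹' s n) * ∏ i ∈ Finset.univ.erase n, ν i (s i) := by
    intro z
    rw [← Finset.mul_prod_erase _ _ (Finset.mem_univ n)]
    congr 1
    · simp
    · refine Finset.prod_congr rfl fun i hi => ?_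
      rw [Pi.single_eq_of_ne (Finset.ne_of_mem_erase hi)]
      simp
  have hm : Measurable fun z : ℂ => ν n ((fun x => z + x) ⁻¹' s n) :=
    measurable_measure_prodMk_left (ν := ν n)
      (s := (fun q : ℂ × ℂ => q.1 + q.2) ⁻¹' s n) (measurable_add (hs n))
  simp_rw [hbox, Measure.pi_pi, hprod]
  rw [lintegral_mul_const _ hm, ← Finset.mul_prod_erase _ _ (Finset.mem_univ n)]
  congr 1
  · rw [Function.update_self, Measure.conv, Measure.map_apply measurable_add (hs n),
      Measure.prod_apply (measurable_add (hs n))]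
    rfl
  · refine Finset.prod_congr rfl fun i hi => ?_
    rw [Function.update_of_ne (Finset.ne_of_mem_erase hi)]

/-! ### Mutual information of an additive-noise channel. -/

section AdditiveNoise

variable {Ω E : Type*} [MeasurableSpace Ω] [AddCommGroup E] [MeasurableSpace E]
  [MeasurableAdd₂ E] [MeasurableSub₂ E]

/-- The shear `(w, x) ↦ (w + x, x)` preserves `μ ⊗ P_X` by translation invariance, so it only
substitutes `y - x` for `w` in the density. No density of `X` is needed; the spatial modulation
symbol lives on the coordinate axes and has none when `N > 1`. -/
lemma map_add_prodMk_eq_withDensity {P : Measure Ω} [IsProbabilityMeasure P] {X W : Ω → E}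
    (hX : AEMeasurable X P) (hW : AEMeasurable W P) (hXW : IndepFun X W P)
    {μ : Measure E} [SigmaFinite μ] [μ.IsAddRightInvariant] {f : E → ℝ≥0∞} (hf : Measurable f)
    (hWf : P.map W = μ.withDensity f) :
    P.map (fun ω => (X ω + W ω, X ω))
      = (μ.prod (P.map X)).withDensity fun z => f (z.1 - z.2) := by
  have hlaw : P.map (fun ω => (W ω, X ω)) = (μ.prod (P.map X)).withDensity fun z => f z.1 := by
    rw [(indepFun_iff_map_prod_eq_prod_map_map hW hX).1 hXW.symm, hWf, prod_withDensity_left hf]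
  have hT : MeasurePreserving (fun z : E × E => (z.1 + z.2, z.2)) (μ.prod (P.map X))
      (μ.prod (P.map X)) := measurePreserving_add_prod μ (P.map X)
  have hcomp : (fun ω => (X ω + W ω, X ω))
      = (fun z : E × E => (z.1 + z.2, z.2)) ∘ fun ω => (W ω, X ω) := by
    ext ω <;> simp [add_comm]
  rw [hcomp, ← AEMeasurable.map_map_of_aemeasurable hT.measurable.aemeasurable (hW.prodMk hX), hlaw]
  refine Measure.ext_of_lintegral _ fun φ hφ => ?_
  have hfs : Measurable fun z : E × E => f (z.1 - z.2) := hf.comp measurable_sub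
  have hf1 : Measurable fun z : E × E => f z.1 := hf.comp measurable_fst
  rw [lintegral_map hφ hT.measurable,
    lintegral_withDensity_eq_lintegral_mul _ hf1
      (g := fun z : E × E => φ (z.1 + z.2, z.2)) (hφ.comp hT.measurable),
    lintegral_withDensity_eq_lintegral_mul _ hfs hφ, ← hT.lintegral_comp (hfs.mul hφ)]
  refine lintegral_congr fun z => ?_
  simp

/-- The mutual information between the input and the output of an additive-noise channel is the
difference of the differential entropies of the output and of the noise. -/
lemma mutualInfo_additive_noise {P : Measure Ω} [IsProbabilityMeasure P] {X W : Ω → E}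
    (hX : AEMeasurable X P) (hW : AEMeasurable W P) (hXW : IndepFun X W P)
    {μ : Measure E} [SigmaFinite μ] [μ.IsAddRightInvariant] {f q : E → ℝ}
    (hf : Measurable f) (hq : Measurable q) (hf0 : ∀ y, 0 < f y) (hq0 : ∀ y, 0 < q y)
    (hWf : P.map W = μ.withDensity fun y => ENNReal.ofReal (f y))
    (hYq : P.map (fun ω => X ω + W ω) = μ.withDensity fun y => ENNReal.ofReal (q y))
    (hf_int : Integrable (fun y => Real.log (f y)) (P.map W))
    (hq_int : Integrable (fun y => Real.log (q y)) (P.map fun ω => X ω + W ω)) :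
    mutualInfo (fun ω => X ω + W ω) X P ≠ ∞ ∧
      (mutualInfo (fun ω => X ω + W ω) X P).toReal
        = ∫ y, Real.log (f y) ∂(P.map W) - ∫ y, Real.log (q y) ∂(P.map fun ω => X ω + W ω) := by
  have hY : AEMeasurable (fun ω => X ω + W ω) P := hX.add hW
  set J := P.map (fun ω => (X ω + W ω, X ω)) with hJ
  set R := (P.map fun ω => X ω + W ω).prod (P.map X) with hR
  have hXp : IsProbabilityMeasure (P.map X) := Measure.isProbabilityMeasure_map hX
  have hYp : IsProbabilityMeasure (P.map fun ω => X ω + W ω) := Measure.isProbabilityMeasure_map hY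
  have hJp : IsProbabilityMeasure J := Measure.isProbabilityMeasure_map (hY.prodMk hX)
  have hfs : Measurable fun z : E × E => f (z.1 - z.2) := hf.comp measurable_sub
  have hq1 : Measurable fun z : E × E => q z.1 := hq.comp measurable_fst
  have hdiv : Measurable fun z : E × E => f (z.1 - z.2) / q z.1 := hfs.div hq1
  have hJR : J = R.withDensity fun z => ENNReal.ofReal (f (z.1 - z.2) / q z.1) := by
    rw [hJ, map_add_prodMk_eq_withDensity hX hW hXW hf.ennreal_ofReal hWf, hR, hYq,
      prod_withDensity_left hq.ennreal_ofReal,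
      ← withDensity_mul _ hq1.ennreal_ofReal hdiv.ennreal_ofReal]
    congr 1
    ext z
    rw [Pi.mul_apply, ← ENNReal.ofReal_mul (hq0 _).le, mul_div_cancel₀ _ (hq0 _).ne']
  have hac : J ≪ R := by rw [hJR]; exact withDensity_absolutelyContinuous _ _
  have hllr : llr J R =ᵐ[J] fun z => Real.log (f (z.1 - z.2)) - Real.log (q z.1) := by
    have h : J.rnDeriv R =ᵐ[R] fun z => ENNReal.ofReal (f (z.1 - z.2) / q z.1) := by
      rw [hJR]; exact Measure.rnDeriv_withDensity _ hdiv.ennreal_ofReal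
    filter_upwards [hac.ae_le h] with z hz
    rw [llr, hz, ENNReal.toReal_ofReal (div_nonneg (hf0 _).le (hq0 _).le),
      Real.log_div (hf0 _).ne' (hq0 _).ne']
  have hfmap : J.map (fun z => z.1 - z.2) = P.map W := by
    rw [hJ, AEMeasurable.map_map_of_aemeasurable measurable_sub.aemeasurable (hY.prodMk hX)]
    congr 1
    ext ω
    simp
  have hqmap : J.map Prod.fst = P.map fun ω => X ω + W ω := by
    rw [hJ, AEMeasurable.map_map_of_aemeasurable measurable_fst.aemeasurable (hY.prodMk hX)]
    rfl
  have hf_int' : Integrable (fun z : E × E => Real.log (f (z.1 - z.2))) J := by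
    rw [← hfmap] at hf_int
    exact hf_int.comp_measurable measurable_sub
  have hq_int' : Integrable (fun z : E × E => Real.log (q z.1)) J := by
    rw [← hqmap] at hq_int
    exact hq_int.comp_measurable measurable_fst
  have hint : Integrable (llr J R) J := (hf_int'.sub hq_int').congr hllr.symm
  refine ⟨InformationTheory.klDiv_ne_top hac hint, ?_⟩
  rw [mutualInfo, InformationTheory.toReal_klDiv_of_measure_eq hac (by simp),
    integral_congr_ae hllr, integral_sub hf_int' hq_int', ← hfmap, ← hqmap,
    integral_map measurable_sub.aemeasurable hf.log.aestronglyMeasurable,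
    integral_map measurable_fst.aemeasurable hq.log.aestronglyMeasurable]

end AdditiveNoise

/-! ### The log-likelihood bound for mixtures. -/

lemma integral_withDensity_ofReal {α : Type*} [MeasurableSpace α] {μ : Measure α} {p : α → ℝ}
    (hp : Measurable p) (hp0 : ∀ y, 0 ≤ p y) (g : α → ℝ) :
    ∫ y, g y ∂(μ.withDensity fun y => ENNReal.ofReal (p y)) = ∫ y, p y * g y ∂μ := by
  rw [integral_withDensity_eq_integral_toReal_smul hp.ennreal_ofReal (by simp)]
  simp [ENNReal.toReal_ofReal (hp0 _)]

lemma integrable_withDensity_ofReal {α : Type*} [MeasurableSpace α] {μ : Measure α} {p : α → ℝ}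
    (hp : Measurable p) (hp0 : ∀ y, 0 ≤ p y) {g : α → ℝ} :
    Integrable g (μ.withDensity fun y => ENNReal.ofReal (p y))
      ↔ Integrable (fun y => p y * g y) μ := by
  rw [integrable_withDensity_iff_integrable_smul' hp.ennreal_ofReal (by simp)]
  simp [ENNReal.toReal_ofReal (hp0 _)]

/-- An upper bound on the expected log-likelihood of a mixture under its components, valid for an
arbitrary family `h` of positive weight functions. -/
lemma sum_integral_log_sum_le {α κ : Type*} [MeasurableSpace α] [Fintype κ]
    {μ : Measure α} {p h : κ → α → ℝ} (hp : ∀ n, Measurable (p n)) (hh : ∀ n, Measurable (h n))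
    (hp0 : ∀ n y, 0 < p n y) (hh0 : ∀ n y, 0 < h n y)
    (hp_int : ∀ n, Integrable (p n) μ) (hp_one : ∀ n, ∫ y, p n y ∂μ = 1)
    {ν : κ → Measure α} [∀ n, IsProbabilityMeasure (ν n)]
    (hν : ∀ n, ν n = μ.withDensity fun y => ENNReal.ofReal (p n y))
    (hlog : ∀ n, Integrable (fun y => Real.log (p n y)) (ν n))
    (hlogsum : ∀ n, Integrable (fun y => Real.log (∑ k, p k y)) (ν n))
    (hratio : ∀ n j, Integrable (fun y => h j y / h n y) (ν n)) :
    ∑ n, ∫ y, Real.log (∑ k, p k y) ∂(ν n)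
      ≤ ∑ n, (∫ y, Real.log (p n y) ∂(ν n) + Real.log (∑ j, ∫ y, h j y / h n y ∂(ν n))) := by
  rcases isEmpty_or_nonempty κ with hκ | hκ
  · simp
  set F : κ → ℝ := fun n => ∑ j, ∫ y, h j y / h n y ∂(ν n) with hF
  have hsp : ∀ y, 0 < ∑ k, p k y := fun y => Finset.sum_pos (fun k _ => hp0 k y) Finset.univ_nonempty
  have hsh : ∀ y, 0 < ∑ k, h k y := fun y => Finset.sum_pos (fun k _ => hh0 k y) Finset.univ_nonempty
  -- The term `j = n` alone equals 1.
  have hF0 : ∀ n, 0 < F n := by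
    intro n
    refine lt_of_lt_of_le one_pos ?_
    calc (1 : ℝ) = ∫ y, h n y / h n y ∂(ν n) := by simp [div_self (hh0 n _).ne']
      _ ≤ F n := Finset.single_le_sum (f := fun j => ∫ y, h j y / h n y ∂(ν n))
          (fun j _ => integral_nonneg fun y => (div_pos (hh0 j y) (hh0 n y)).le)
          (Finset.mem_univ n)
  -- Against `p n` the Gibbs factor becomes the mixture times a normalized weight in `(0, 1]`, so it
  -- is dominated by the mixture and integrable.
  have hG_eq : ∀ n y, p n y * ((∑ k, p k y) * h n y / (p n y * ∑ j, h j y))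
      = (∑ k, p k y) * (h n y / ∑ j, h j y) := by
    intro n y
    have := hp0 n y
    have := hsh y
    field_simp
  have hspm : Measurable fun y => ∑ k, p k y := Finset.measurable_fun_sum _ fun k _ => hp k
  have hshm : Measurable fun y => ∑ k, h k y := Finset.measurable_fun_sum _ fun k _ => hh k
  have hsp_int : Integrable (fun y => ∑ k, p k y) μ := integrable_finsetSum _ fun k _ => hp_int k
  have hGμ : ∀ n, Integrable (fun y => (∑ k, p k y) * (h n y / ∑ j, h j y)) μ := by
    intro n
    refine hsp_int.mono' (hspm.mul ((hh n).div hshm)).aestronglyMeasurable (ae_of_all _ fun y => ?_)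
    rw [Real.norm_of_nonneg (mul_nonneg (hsp y).le (div_pos (hh0 n y) (hsh y)).le)]
    refine mul_le_of_le_one_right (hsp y).le ((div_le_one (hsh y)).2 ?_)
    exact Finset.single_le_sum (f := fun j => h j y) (fun j _ => (hh0 j y).le) (Finset.mem_univ n)
  have hG : ∀ n, Integrable (fun y => (∑ k, p k y) * h n y / (p n y * ∑ j, h j y)) (ν n) := by
    intro n
    rw [hν n, integrable_withDensity_ofReal (hp n) fun y => (hp0 n y).le]
    simp_rw [hG_eq]
    exact hGμ n
  have hsum_ratio : ∀ n, Integrable (fun y => ∑ j, h j y / h n y) (ν n) := fun n =>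
    integrable_finsetSum _ fun j _ => hratio n j
  -- Factorization of the mixture with the Jensen factor normalized by its mean `F n`; `log x ≤ x -
  -- 1` is used for both remaining factors, whence the `-2`.
  have hpt : ∀ n y, Real.log (∑ k, p k y) ≤ Real.log (p n y) + Real.log (F n)
      + (∑ j, h j y / h n y) / F n
      + (∑ k, p k y) * h n y / (p n y * ∑ j, h j y) - 2 := by
    intro n y
    have h1 : 0 < (∑ j, h j y / h n y) / F n :=
      div_pos (Finset.sum_pos (fun j _ => div_pos (hh0 j y) (hh0 n y)) Finset.univ_nonempty) (hF0 n)
    have h2 : 0 < (∑ k, p k y) * h n y / (p n y * ∑ j, h j y) :=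
      div_pos (mul_pos (hsp y) (hh0 n y)) (mul_pos (hp0 n y) (hsh y))
    have h3 : ∑ k, p k y = p n y * F n * ((∑ j, h j y / h n y) / F n)
        * ((∑ k, p k y) * h n y / (p n y * ∑ j, h j y)) := by
      rw [← Finset.sum_div]
      have := hp0 n y
      have := hh0 n y
      have := hF0 n
      have := hsh y
      field_simp
    have h4 := Real.log_le_sub_one_of_pos h1
    have h5 := Real.log_le_sub_one_of_pos h2
    have h6 := congrArg Real.log h3
    rw [Real.log_mul (by have := hp0 n y; have := hF0 n; positivity) h2.ne',
      Real.log_mul (mul_pos (hp0 n y) (hF0 n)).ne' h1.ne',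
      Real.log_mul (hp0 n y).ne' (hF0 n).ne'] at h6
    linarith
  have hle : ∀ n, ∫ y, Real.log (∑ k, p k y) ∂(ν n) ≤ ∫ y, Real.log (p n y) ∂(ν n)
      + Real.log (F n) + 1 + ∫ y, (∑ k, p k y) * (h n y / ∑ j, h j y) ∂μ - 2 := by
    intro n
    have i1 := (hlog n).add (integrable_const (Real.log (F n)))
    have i2 := i1.add ((hsum_ratio n).div_const (F n))
    have i3 := i2.add (hG n)
    have i4 := i3.sub (integrable_const (2 : ℝ))
    refine (integral_mono (hlogsum n) i4 fun y => hpt n y).trans_eq ?_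
    rw [integral_sub' i3 (integrable_const _), integral_add' i2 (hG n),
      integral_add' i1 ((hsum_ratio n).div_const (F n)), integral_add' (hlog n) (integrable_const _),
      integral_div, integral_finsetSum _ fun j _ => hratio n j]
    have hGval : ∫ y, (∑ k, p k y) * h n y / (p n y * ∑ j, h j y) ∂(ν n)
        = ∫ y, (∑ k, p k y) * (h n y / ∑ j, h j y) ∂μ := by
      rw [hν n, integral_withDensity_ofReal (hp n) fun y => (hp0 n y).le]
      simp_rw [hG_eq]
    rw [hGval, show (∑ j, ∫ y, h j y / h n y ∂(ν n)) / F n = 1 from div_self (hF0 n).ne']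
    simp
  -- The normalized weights sum to 1. With the Jensen factors of mean 1, the total excess is `card κ
  -- + card κ - 2 card κ = 0`.
  have htot : ∑ n, ∫ y, (∑ k, p k y) * (h n y / ∑ j, h j y) ∂μ = Fintype.card κ := by
    rw [← integral_finsetSum _ fun n _ => hGμ n]
    have : ∀ y, ∑ n, (∑ k, p k y) * (h n y / ∑ j, h j y) = ∑ k, p k y := by
      intro y
      rw [← Finset.mul_sum, ← Finset.sum_div, div_self (hsh y).ne', mul_one]
    simp_rw [this]
    rw [integral_finsetSum _ fun n _ => hp_int n]
    simp [hp_one]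
  refine (Finset.sum_le_sum fun n _ => hle n).trans_eq ?_
  simp only [Finset.sum_sub_distrib, Finset.sum_add_distrib, htot]
  simp
  ring

/-! ### The mixture bound for Gaussian components. -/

lemma gaussDensity_mul_ratio {u v : ℝ} (hu : 0 < u) (hv : 0 < v) (z : ℂ) :
    gaussDensity u z * (gaussDensity (2 * v) z / gaussDensity (2 * u) z)
      = 2 * u / (u + v) * gaussDensity (2 * u * v / (u + v)) z := by
  have he : Real.exp (-‖z‖ ^ 2 / (2 * u * v / (u + v))) * Real.exp (-‖z‖ ^ 2 / (2 * u))
      = Real.exp (-‖z‖ ^ 2 / u) * Real.exp (-‖z‖ ^ 2 / (2 * v)) := by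
    rw [← Real.exp_add, ← Real.exp_add]
    congr 1
    field_simp
    ring
  have hpi := Real.pi_pos
  have h2 := Real.exp_pos (-‖z‖ ^ 2 / (2 * u))
  rw [mul_div_assoc', div_eq_iff (gaussDensity_pos (by positivity) z).ne']
  unfold gaussDensity
  generalize Real.exp (-‖z‖ ^ 2 / (2 * u * v / (u + v))) = e1 at *
  generalize Real.exp (-‖z‖ ^ 2 / (2 * u)) = e2 at *
  generalize Real.exp (-‖z‖ ^ 2 / u) = e3 at *
  generalize Real.exp (-‖z‖ ^ 2 / (2 * v)) = e4 at *
  field_simp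
  linear_combination -he

section Vector

variable {N : ℕ}

/-- In each coordinate the precisions combine to `1/u + 1/(2v) - 1/(2u) = (u + v)/(2uv)`. Doubling
the variances in the weights keeps this positive for all `u, v`, so the tilted density is again
Gaussian and its mass can be read off. -/
lemma gaussDiagDensity_mul_ratio {u v : Fin N → ℝ} (hu : ∀ i, 0 < u i) (hv : ∀ i, 0 < v i)
    (y : Fin N → ℂ) :
    gaussDiagDensity u y
        * (gaussDiagDensity (fun i => 2 * v i) y / gaussDiagDensity (fun i => 2 * u i) y)
      = (∏ i, 2 * u i / (u i + v i))
        * gaussDiagDensity (fun i => 2 * u i * v i / (u i + v i)) y := by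
  unfold gaussDiagDensity
  rw [← Finset.prod_div_distrib, ← Finset.prod_mul_distrib, ← Finset.prod_mul_distrib]
  exact Finset.prod_congr rfl fun i _ => gaussDensity_mul_ratio (hu i) (hv i) (y i)

lemma integrable_gaussDiagDensity_ratio {u v : Fin N → ℝ} (hu : ∀ i, 0 < u i)
    (hv : ∀ i, 0 < v i) :
    Integrable (fun y => gaussDiagDensity (fun i => 2 * v i) y
      / gaussDiagDensity (fun i => 2 * u i) y) (complexGaussianDiag u) := by
  rw [complexGaussianDiag_eq_withDensity hu, integrable_withDensity_ofReal
    (measurable_gaussDiagDensity u) fun y => (gaussDiagDensity_pos hu y).le]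
  simp_rw [gaussDiagDensity_mul_ratio hu hv]
  refine (integrable_gaussDiagDensity fun i => ?_).const_mul _
  have := hu i
  have := hv i
  positivity

lemma integral_gaussDiagDensity_ratio {u v : Fin N → ℝ} (hu : ∀ i, 0 < u i)
    (hv : ∀ i, 0 < v i) :
    ∫ y, gaussDiagDensity (fun i => 2 * v i) y / gaussDiagDensity (fun i => 2 * u i) y
      ∂(complexGaussianDiag u) = ∏ i, 2 * u i / (u i + v i) := by
  rw [complexGaussianDiag_eq_withDensity hu, integral_withDensity_ofReal
    (measurable_gaussDiagDensity u) fun y => (gaussDiagDensity_pos hu y).le]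
  simp_rw [gaussDiagDensity_mul_ratio hu hv]
  rw [integral_const_mul, integral_gaussDiagDensity, mul_one]
  intro i
  have := hu i
  have := hv i
  positivity

lemma gaussDiagDensity_le {d : Fin N → ℝ} (hd : ∀ i, 0 < d i) (y : Fin N → ℂ) :
    gaussDiagDensity d y ≤ ∏ i, (Real.pi * d i)⁻¹ := by
  refine Finset.prod_le_prod (fun i _ => (gaussDensity_pos (hd i) _).le) fun i _ => ?_
  have := hd i
  refine mul_le_of_le_one_right (by positivity) (Real.exp_le_one_iff.2 ?_)
  exact div_nonpos_of_nonpos_of_nonneg (by simp) this.le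

/-- The logarithm lies between that of a single component, which is quadratic in `y`, and a
constant. -/
lemma integrable_log_sum_gaussDiagDensity {κ : Type*} [Fintype κ] [Nonempty κ]
    {v : κ → Fin N → ℝ} (hv : ∀ n i, 0 < v n i) (u : Fin N → ℝ) :
    Integrable (fun y => Real.log (∑ k, gaussDiagDensity (v k) y)) (complexGaussianDiag u) := by
  obtain ⟨n⟩ := ‹Nonempty κ›
  refine integrable_of_le_of_le (Measurable.aestronglyMeasurable ?_) (ae_of_all _ fun y => ?_)
    (ae_of_all _ fun y => ?_) (integrable_log_gaussDiagDensity (hv n) u)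
    (integrable_const (Real.log (∑ k, ∏ i, (Real.pi * v k i)⁻¹)))
  · exact (Finset.measurable_fun_sum _ fun k _ => measurable_gaussDiagDensity (v k)).log
  · exact Real.log_le_log (gaussDiagDensity_pos (hv n) y)
      (Finset.single_le_sum (f := fun k => gaussDiagDensity (v k) y)
        (fun k _ => (gaussDiagDensity_pos (hv k) y).le) (Finset.mem_univ n))
  · exact Real.log_le_log
      (Finset.sum_pos (fun k _ => gaussDiagDensity_pos (hv k) y) ⟨n, Finset.mem_univ n⟩)
      (Finset.sum_le_sum fun k _ => gaussDiagDensity_le (hv k) y)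

lemma sum_integral_log_sum_gaussDiagDensity_le {κ : Type*} [Fintype κ] [Nonempty κ]
    {v : κ → Fin N → ℝ} (hv : ∀ n i, 0 < v n i) :
    ∑ n, ∫ y, Real.log (∑ k, gaussDiagDensity (v k) y) ∂(complexGaussianDiag (v n))
      ≤ ∑ n, (-∑ i, Real.log (Real.pi * v n i) - N
        + Real.log (∑ k, ∏ i, 2 * v n i / (v n i + v k i))) := by
  have hv2 : ∀ n i, 0 < 2 * v n i := fun n i => by have := hv n i; positivity
  refine (sum_integral_log_sum_le (μ := volume) (p := fun n => gaussDiagDensity (v n))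
    (h := fun n => gaussDiagDensity fun i => 2 * v n i)
    (fun n => measurable_gaussDiagDensity _) (fun n => measurable_gaussDiagDensity _)
    (fun n => gaussDiagDensity_pos (hv n)) (fun n => gaussDiagDensity_pos (hv2 n))
    (fun n => integrable_gaussDiagDensity (hv n)) (fun n => integral_gaussDiagDensity (hv n))
    (ν := fun n => complexGaussianDiag (v n)) (fun n => complexGaussianDiag_eq_withDensity (hv n))
    (fun n => integrable_log_gaussDiagDensity (hv n) _)
    (fun n => integrable_log_sum_gaussDiagDensity hv _)
    (fun n j => integrable_gaussDiagDensity_ratio (hv n) (hv j))).trans_eq ?_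
  refine Finset.sum_congr rfl fun n _ => ?_
  rw [integral_log_gaussDiagDensity (hv n)]
  simp_rw [integral_gaussDiagDensity_ratio (hv n) (hv _)]

/-! ### The output law of the spatial modulation channel. -/

lemma measurable_smSymbol : Measurable fun q : ℂ × Fin N => smSymbol q.1 q.2 :=
  measurable_from_prod_countable_left fun n =>
    (measurable_single n).comp (measurable_const.mul measurable_id)

/-- The law of the output of the equivalent channel, conditionally on the active antenna `n`, when
the noise is `CN(0, diag d)`. -/
lemma map_smSymbol_add {d : Fin N → ℝ} (hd : ∀ i, 0 < d i) (n : Fin N) :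
    ((complexGaussian 1).prod (complexGaussianDiag d)).map
        (fun q : ℂ × (Fin N → ℂ) => smSymbol q.1 n + q.2)
      = complexGaussianDiag fun i => d i + N * (Pi.single n 1 : Fin N → ℝ) i := by
  have hm : Measurable fun z : ℂ => ((Real.sqrt N : ℝ) : ℂ) * z := by fun_prop
  have hadd : Measurable fun q : ℂ × (Fin N → ℂ) => (Pi.single n q.1 + q.2 : Fin N → ℂ) :=
    ((measurable_single n).comp measurable_fst).add measurable_snd
  have hsplit : (fun q : ℂ × (Fin N → ℂ) => smSymbol q.1 n + q.2)
      = (fun q : ℂ × (Fin N → ℂ) => (Pi.single n q.1 + q.2 : Fin N → ℂ))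
        ∘ Prod.map (fun z => ((Real.sqrt N : ℝ) : ℂ) * z) id := by
    ext q; simp [smSymbol]
  have hscale : (complexGaussian 1).map (fun z => ((Real.sqrt N : ℝ) : ℂ) * z)
      = complexGaussian N := by
    rw [complexGaussian_map_mul zero_le_one, Real.sq_sqrt (Nat.cast_nonneg N), mul_one]
  rw [hsplit, ← Measure.map_map hadd (hm.prodMap measurable_id), ← Measure.map_prod_map _ _ hm measurable_id, Measure.map_id, hscale]
  unfold complexGaussianDiag
  rw [map_single_add_prod_pi]
  congr 1
  ext1 i
  by_cases h : i = n
  · subst h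
    rw [Function.update_self, complexGaussian_conv (Nat.cast_nonneg N) (hd i).le]
    simp [add_comm]
  · simp [Function.update_of_ne h, Pi.single_eq_of_ne h]

/-- The output of the equivalent channel is a uniform mixture of complex Gaussian vectors. -/
lemma map_smSymbol_add_noise {Ω : Type*} [MeasurableSpace Ω] {P : Measure Ω}
    [IsProbabilityMeasure P] {s : Ω → ℂ} {a : Ω → Fin N} {w : Ω → Fin N → ℂ} {d : Fin N → ℝ}
    (hd : ∀ i, 0 < d i) (hs : HasLaw s (complexGaussian 1) P)
    (ha : AEMeasurable a P) (ha_unif : ∀ n, P {ω | a ω = n} = (N : ℝ≥0∞)⁻¹)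
    (hw : HasLaw w (complexGaussianDiag d) P) (hsa : IndepFun s a P)
    (hsaw : IndepFun (fun ω => (s ω, a ω)) w P) :
    P.map (fun ω => smSymbol (s ω) (a ω) + w ω) = ∑ n, (N : ℝ≥0∞)⁻¹ •
      complexGaussianDiag fun i => d i + N * (Pi.single n 1 : Fin N → ℝ) i := by
  have hsam : AEMeasurable (fun ω => (s ω, a ω)) P := hs.aemeasurable.prodMk ha
  have hlaw : P.map (fun ω => ((s ω, a ω), w ω))
      = ((complexGaussian 1).prod (P.map a)).prod (complexGaussianDiag d) := by
    rw [(indepFun_iff_map_prod_eq_prod_map_map hsam hw.aemeasurable).1 hsaw,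
      (indepFun_iff_map_prod_eq_prod_map_map hs.aemeasurable ha).1 hsa, hs.map_eq, hw.map_eq]
  have haP : IsProbabilityMeasure (P.map a) := Measure.isProbabilityMeasure_map ha
  have hf : Measurable fun q : (ℂ × Fin N) × (Fin N → ℂ) => smSymbol q.1.1 q.1.2 + q.2 :=
    (measurable_smSymbol.comp measurable_fst).add measurable_snd
  have hfn : ∀ n, Measurable fun q : ℂ × (Fin N → ℂ) => smSymbol q.1 n + q.2 := fun n =>
    hf.comp ((measurable_fst.prodMk measurable_const).prodMk measurable_snd)
  have hcomp : P.map (fun ω => smSymbol (s ω) (a ω) + w ω)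
      = (P.map fun ω => ((s ω, a ω), w ω)).map
        fun q : (ℂ × Fin N) × (Fin N → ℂ) => smSymbol q.1.1 q.1.2 + q.2 := by
    rw [AEMeasurable.map_map_of_aemeasurable hf.aemeasurable (hsam.prodMk hw.aemeasurable)]
    rfl
  have hpt : ∀ n, P.map a {n} = (N : ℝ≥0∞)⁻¹ := fun n => by
    rw [Measure.map_apply_of_aemeasurable ha (measurableSet_singleton n), ← ha_unif n]; rfl
  rw [hcomp, hlaw]
  ext B hB
  -- Integrating over the antenna last turns the outer integral into a finite sum over the
  -- conditional laws.
  rw [Measure.map_apply hf hB, Measure.prod_apply (hf hB),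
    lintegral_prod_symm' _ (measurable_measure_prodMk_left (hf hB)), lintegral_fintype,
    Measure.finsetSum_apply]
  refine Finset.sum_congr rfl fun n _ => ?_
  rw [hpt, mul_comm, Measure.smul_apply, smul_eq_mul, ← map_smSymbol_add hd n,
    Measure.map_apply (hfn n) hB, Measure.prod_apply (hfn n hB)]
  rfl

/-! ### The closed form and the bound for arbitrary positive SINRs. -/

lemma det_covMatrix (S : Fin N → ℝ) (n : Fin N) :
    (covMatrix S n).det = ∏ i, (1 / S i + N * (Pi.single n 1 : Fin N → ℝ) i) := by
  rw [covMatrix, ← Matrix.diagonal_smul, Matrix.diagonal_add, Matrix.det_diagonal]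
  simp

lemma det_covMatrix_add (S : Fin N → ℝ) (n k : Fin N) :
    (covMatrix S n + covMatrix S k).det
      = ∏ i, ((1 / S i + N * (Pi.single n 1 : Fin N → ℝ) i)
        + (1 / S i + N * (Pi.single k 1 : Fin N → ℝ) i)) := by
  rw [covMatrix, covMatrix, ← Matrix.diagonal_smul, ← Matrix.diagonal_smul, Matrix.diagonal_add,
    Matrix.diagonal_add, Matrix.diagonal_add, Matrix.det_diagonal]
  simp

/-- Converts the entropy expression in nats to the closed form: the entropy constants `N` of noise
and components cancel, and the surviving `-N` comes from the `2 ^ N` in the determinant ratio. -/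
lemma seBound_mul_log_two (hN : 0 < N) {S : Fin N → ℝ} (hS : ∀ n, 0 < S n)
    {v : Fin N → Fin N → ℝ} (hv : ∀ n i, v n i = 1 / S i + N * (Pi.single n 1 : Fin N → ℝ) i) :
    seBound S * Real.log 2 = -∑ i, Real.log (Real.pi * (1 / S i)) - N + Real.log N
      - (N : ℝ)⁻¹ * ∑ n, (-∑ i, Real.log (Real.pi * v n i) - N
        + Real.log (∑ k, ∏ i, 2 * v n i / (v n i + v k i))) := by
  have hN' : (0 : ℝ) < N := Nat.cast_pos.2 hN
  have : Nonempty (Fin N) := ⟨⟨0, hN⟩⟩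
  have hl2 : 0 < Real.log 2 := Real.log_pos one_lt_two
  have hv0 : ∀ n i, 0 < v n i := fun n i => by
    have hsingle : (0 : Fin N → ℝ) ≤ Pi.single n 1 := Pi.single_nonneg.2 zero_le_one
    have h : (0 : ℝ) ≤ (Pi.single n 1 : Fin N → ℝ) i := hsingle i
    rw [hv]
    exact add_pos_of_pos_of_nonneg (one_div_pos.2 (hS i)) (by positivity)
  have hF : ∀ n, Real.log (∑ k, ∏ i, 2 * v n i / (v n i + v k i)) = N * Real.log 2
      + Real.log (∑ k, (covMatrix S n).det / (covMatrix S n + covMatrix S k).det) := by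
    intro n
    have hratio : ∀ k, ∏ i, 2 * v n i / (v n i + v k i)
        = 2 ^ N * ((covMatrix S n).det / (covMatrix S n + covMatrix S k).det) := by
      intro k
      rw [det_covMatrix, det_covMatrix_add]
      simp_rw [← hv]
      rw [Finset.prod_div_distrib, Finset.prod_mul_distrib]
      simp [mul_div_assoc]
    have hpos : 0 < ∑ k, (covMatrix S n).det / (covMatrix S n + covMatrix S k).det := by
      refine Finset.sum_pos (fun k _ => ?_) Finset.univ_nonempty
      rw [det_covMatrix, det_covMatrix_add]
      simp_rw [← hv]
      exact div_pos (Finset.prod_pos fun i _ => hv0 n i)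
        (Finset.prod_pos fun i _ => add_pos (hv0 n i) (hv0 k i))
    simp_rw [hratio]
    rw [← Finset.mul_sum, Real.log_mul (by positivity) hpos.ne', Real.log_pow]
  -- Signal and noise covariances differ only in coordinate `n`, where the variance ratio is `1 + N
  -- * S n`.
  have hD : ∀ n, ∑ i, Real.log (Real.pi * v n i)
      = ∑ i, Real.log (Real.pi * (1 / S i)) + Real.log (1 + N * S n) := by
    intro n
    rw [← sub_eq_iff_eq_add', ← Finset.sum_sub_distrib, Finset.sum_eq_single n]
    · have := hS n
      have := Real.pi_pos
      rw [hv, ← Real.log_div (by simp; positivity) (by positivity)]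
      congr 1
      simp
      field_simp
    · intro i _ hi
      rw [hv, Pi.single_eq_of_ne hi]
      simp
    · simp
  simp_rw [hF, hD]
  unfold seBound
  simp only [Real.logb, ← Finset.sum_div, Finset.sum_add_distrib, Finset.sum_sub_distrib,
    Finset.sum_neg_distrib, Finset.sum_const, Finset.card_univ, Fintype.card_fin, nsmul_eq_mul]
  field_simp
  ring

lemma integrable_mixture {α κ E : Type*} [MeasurableSpace α] [Fintype κ] [NormedAddCommGroup E]
    {ν : κ → Measure α} {c : ℝ≥0∞} (hc : c ≠ ∞) {f : α → E} (hf : ∀ n, Integrable f (ν n)) :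
    Integrable f (∑ n, c • ν n) :=
  integrable_finsetSum_measure.2 fun n _ => (hf n).smul_measure hc

/-- The closed form `seBound` is a lower bound on the mutual information of the equivalent channel,
for arbitrary positive signal-to-noise ratios. -/
theorem seBound_le_mutualInfo (hN : 0 < N) {S : Fin N → ℝ} (hS : ∀ n, 0 < S n)
    {Ω : Type*} [MeasurableSpace Ω] (P : Measure Ω) [IsProbabilityMeasure P]
    {s : Ω → ℂ} {a : Ω → Fin N} {w : Ω → Fin N → ℂ} (hs : HasLaw s (complexGaussian 1) P)
    (ha : AEMeasurable a P) (ha_unif : ∀ n, P {ω | a ω = n} = (N : ℝ≥0∞)⁻¹)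
    (hw : HasLaw w (complexGaussianDiag fun n => 1 / S n) P) (hsa : IndepFun s a P)
    (hsaw : IndepFun (fun ω => (s ω, a ω)) w P) :
    mutualInfo (fun ω => smSymbol (s ω) (a ω) + w ω) (fun ω => smSymbol (s ω) (a ω)) P ≠ ∞ ∧
      seBound S ≤ (mutualInfo (fun ω => smSymbol (s ω) (a ω) + w ω)
        (fun ω => smSymbol (s ω) (a ω)) P).toReal / Real.log 2 := by
  have hN' : (0 : ℝ) < N := Nat.cast_pos.2 hN
  have : Nonempty (Fin N) := ⟨⟨0, hN⟩⟩
  have hd : ∀ i, 0 < 1 / S i := fun i => one_div_pos.2 (hS i)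
  set v : Fin N → Fin N → ℝ := fun n i => 1 / S i + N * (Pi.single n 1 : Fin N → ℝ) i with hv
  have hv0 : ∀ n i, 0 < v n i := fun n i => by
    have hsingle : (0 : Fin N → ℝ) ≤ Pi.single n 1 := Pi.single_nonneg.2 zero_le_one
    have h : (0 : ℝ) ≤ (Pi.single n 1 : Fin N → ℝ) i := hsingle i
    exact add_pos_of_pos_of_nonneg (hd i) (by positivity)
  have hc : (N : ℝ≥0∞)⁻¹ ≠ ∞ := by simpa using hN.ne'
  have hY := map_smSymbol_add_noise hd hs ha ha_unif hw hsa hsaw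
  have hsum0 : ∀ y, 0 < ∑ k, gaussDiagDensity (v k) y := fun y =>
    Finset.sum_pos (fun k _ => gaussDiagDensity_pos (hv0 k) y) Finset.univ_nonempty
  have hsum_meas : Measurable fun y => ∑ k, gaussDiagDensity (v k) y :=
    Finset.measurable_fun_sum _ fun k _ => measurable_gaussDiagDensity (v k)
  set q : (Fin N → ℂ) → ℝ := fun y => (N : ℝ)⁻¹ * ∑ k, gaussDiagDensity (v k) y with hq
  have hq0 : ∀ y, 0 < q y := fun y => mul_pos (inv_pos.2 hN') (hsum0 y)
  have hYq : P.map (fun ω => smSymbol (s ω) (a ω) + w ω)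
      = volume.withDensity fun y => ENNReal.ofReal (q y) := by
    rw [hY]
    ext B hB
    rw [withDensity_apply _ hB, Measure.finsetSum_apply]
    have hqe : ∀ y, ENNReal.ofReal (q y)
        = ∑ k, (N : ℝ≥0∞)⁻¹ * ENNReal.ofReal (gaussDiagDensity (v k) y) := by
      intro y
      rw [hq, ENNReal.ofReal_mul (by positivity), ENNReal.ofReal_inv_of_pos hN',
        ENNReal.ofReal_natCast, ENNReal.ofReal_sum_of_nonneg fun k _ =>
          (gaussDiagDensity_pos (hv0 k) y).le, Finset.mul_sum]
    simp_rw [hqe]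
    rw [lintegral_finsetSum _ fun k _ => by fun_prop]
    refine Finset.sum_congr rfl fun n _ => ?_
    rw [lintegral_const_mul _ (by fun_prop), Measure.smul_apply, smul_eq_mul,
      complexGaussianDiag_eq_withDensity (hv0 n), withDensity_apply _ hB]
  have hlogq : ∀ y, Real.log (q y)
      = Real.log (∑ k, gaussDiagDensity (v k) y) - Real.log N := by
    intro y
    rw [hq, Real.log_mul (by positivity) (hsum0 y).ne', Real.log_inv]
    ring
  have hlog_int : ∀ n, Integrable (fun y => Real.log (q y)) (complexGaussianDiag (v n)) := by
    intro n
    simp_rw [hlogq]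
    exact (integrable_log_sum_gaussDiagDensity hv0 (v n)).sub (integrable_const _)
  have hX : AEMeasurable (fun ω => smSymbol (s ω) (a ω)) P :=
    measurable_smSymbol.comp_aemeasurable (hs.aemeasurable.prodMk ha)
  have hXW : IndepFun (fun ω => smSymbol (s ω) (a ω)) w P :=
    hsaw.comp measurable_smSymbol measurable_id
  obtain ⟨hfin, hval⟩ := mutualInfo_additive_noise hX hw.aemeasurable hXW (μ := volume)
    (q := q) (measurable_gaussDiagDensity fun i => 1 / S i) (hsum_meas.const_mul _)
    (gaussDiagDensity_pos hd) hq0 (by rw [hw.map_eq, complexGaussianDiag_eq_withDensity hd]) hYq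
    (by rw [hw.map_eq]; exact integrable_log_gaussDiagDensity hd _)
    (by rw [hY]; exact integrable_mixture hc hlog_int)
  refine ⟨hfin, ?_⟩
  rw [le_div_iff₀ (Real.log_pos one_lt_two), hval, seBound_mul_log_two hN hS (v := v) fun _ _ => rfl,
    hw.map_eq, integral_log_gaussDiagDensity hd, hY,
    integral_finsetSum_measure fun n _ => (hlog_int n).smul_measure hc]
  have hterm : ∀ n, ∫ y, Real.log (q y) ∂((N : ℝ≥0∞)⁻¹ • complexGaussianDiag (v n))
      = (N : ℝ)⁻¹ * (∫ y, Real.log (∑ k, gaussDiagDensity (v k) y) ∂(complexGaussianDiag (v n))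
        - Real.log N) := by
    intro n
    rw [integral_smul_measure]
    simp_rw [hlogq]
    rw [integral_sub (integrable_log_sum_gaussDiagDensity hv0 (v n)) (integrable_const _)]
    simp
  have hsum := mul_le_mul_of_nonneg_left (sum_integral_log_sum_gaussDiagDensity_le hv0)
    (inv_nonneg.2 hN'.le)
  have htotal : ∑ n, ∫ y, Real.log (q y) ∂((N : ℝ≥0∞)⁻¹ • complexGaussianDiag (v n))
      = (N : ℝ)⁻¹ * ∑ n, ∫ y, Real.log (∑ k, gaussDiagDensity (v k) y)
        ∂(complexGaussianDiag (v n)) - Real.log N := by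
    simp_rw [hterm]
    rw [← Finset.mul_sum, Finset.sum_sub_distrib]
    simp only [Finset.sum_const, Finset.card_univ, Fintype.card_fin, nsmul_eq_mul]
    field_simp
  rw [htotal]
  linarith

end Vector

/-! ### Positivity of the SINR. -/

lemma norm_integral_sq_le {α : Type*} [MeasurableSpace α] {μ : Measure α} [IsProbabilityMeasure μ]
    {f : α → ℂ} (hf : MemLp f 2 μ) : ‖∫ x, f x ∂μ‖ ^ 2 ≤ ∫ x, ‖f x‖ ^ 2 ∂μ := by
  have h := variance_nonneg (fun x => ‖f x‖) μ
  rw [variance_eq_sub hf.norm] at h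
  have h1 : ‖∫ x, f x ∂μ‖ ^ 2 ≤ (∫ x, ‖f x‖ ∂μ) ^ 2 :=
    pow_le_pow_left₀ (norm_nonneg _) (norm_integral_le_integral_norm _) 2
  exact h1.trans (sub_nonneg.1 h)

/-- The subtracted squared mean is at most the `k = n` summand of the mobile-layer sum. The same
estimate makes the fixed-layer interference strictly positive, so the denominator is positive even
without noise. -/
lemma sinr_pos {Nt Nr : ℕ} {ρml ρfl σsq : ℝ} (hρml : 0 < ρml) (hρfl : 0 < ρfl) (hσ : 0 ≤ σsq)
    {g : Fin Nt → Channel Nt Nr → Fin Nr → ℂ} {n : Fin Nt}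
    (hgain : ∀ k, MemLp (gain g n k) 2 (rayleigh Nt Nr))
    (hmean : ∫ H, gain g n n H ∂(rayleigh Nt Nr) ≠ 0) : 0 < sinr ρml ρfl σsq g n := by
  have hNt : (0 : ℝ) < Nt := Nat.cast_pos.2 n.pos
  have hm : 0 < ‖∫ H, gain g n n H ∂(rayleigh Nt Nr)‖ ^ 2 := by
    have := norm_pos_iff.2 hmean
    positivity
  have hsum : ∀ ρ : ℝ, 0 < ρ → ρ / Nt * ‖∫ H, gain g n n H ∂(rayleigh Nt Nr)‖ ^ 2
      ≤ ∑ k, ρ / Nt * ∫ H, ‖gain g n k H‖ ^ 2 ∂(rayleigh Nt Nr) := fun ρ hρ =>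
    (mul_le_mul_of_nonneg_left (norm_integral_sq_le (hgain n)) (by positivity)).trans
      (Finset.single_le_sum
        (f := fun k => ρ / Nt * ∫ H, ‖gain g n k H‖ ^ 2 ∂(rayleigh Nt Nr))
        (fun k _ => mul_nonneg (by positivity) (integral_nonneg fun H => by positivity))
        (Finset.mem_univ n))
  have h1 := hsum ρml hρml
  have h2 := hsum ρfl hρfl
  have h3 : 0 < ρfl / Nt * ‖∫ H, gain g n n H ∂(rayleigh Nt Nr)‖ ^ 2 := by positivity
  have h4 : 0 ≤ σsq * ∫ H, ∑ r, ‖g n H r‖ ^ 2 ∂(rayleigh Nt Nr) :=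
    mul_nonneg hσ (integral_nonneg fun H => by positivity)
  exact div_pos (by positivity) (by linarith)

end SMLDM

theorem theorem1
    {Nt Nr : ℕ} (hNt : 0 < Nt)
    -- transmit powers of the mobile and of the fixed layer, noise variance of the mobile layer
    (ρml ρfl σsq : ℝ) (hρfl : 0 < ρfl) (hρml : ρfl < ρml) (hσ : 0 < σsq)
    -- combining vectors, with finite second moments and non-vanishing mean useful gains
    (g : Fin Nt → SMLDM.Channel Nt Nr → Fin Nr → ℂ)
    (hg : ∀ n r, MemLp (fun H => g n H r) 2 (SMLDM.rayleigh Nt Nr))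
    (hgain : ∀ n k, MemLp (SMLDM.gain g n k) 2 (SMLDM.rayleigh Nt Nr))
    (hmean : ∀ n, ∫ H, SMLDM.gain g n n H ∂(SMLDM.rayleigh Nt Nr) ≠ 0)
    -- constellation symbol, active antenna and noise of the equivalent channel
    {Ω : Type*} [MeasurableSpace Ω] (P : Measure Ω) [IsProbabilityMeasure P]
    (s : Ω → ℂ) (a : Ω → Fin Nt) (w : Ω → Fin Nt → ℂ)
    (hs : HasLaw s (SMLDM.complexGaussian 1) P)
    (ha : AEMeasurable a P) (ha_unif : ∀ n, P {ω | a ω = n} = (Nt : ℝ≥0∞)⁻¹)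
    (hw : HasLaw w
      (SMLDM.complexGaussianDiag (fun n => 1 / SMLDM.sinr ρml ρfl σsq g n)) P)
    (hsa : IndepFun s a P) (hsaw : IndepFun (fun ω => (s ω, a ω)) w P) :
    SMLDM.mutualInfo (fun ω => SMLDM.smSymbol (s ω) (a ω) + w ω)
        (fun ω => SMLDM.smSymbol (s ω) (a ω)) P ≠ ∞ ∧
      SMLDM.seBound (SMLDM.sinr ρml ρfl σsq g) ≤
        (SMLDM.mutualInfo (fun ω => SMLDM.smSymbol (s ω) (a ω) + w ω)
          (fun ω => SMLDM.smSymbol (s ω) (a ω)) P).toReal / Real.log 2 :=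
  SMLDM.seBound_le_mutualInfo hNt
    (fun n => SMLDM.sinr_pos (hρfl.trans hρml) hρfl hσ.le (hgain n) (hmean n)) P hs ha ha_unif hw hsa
    hsaw
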